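/- Let $\mu$ be a probability measure on $\mathbb{R}$ satisfying condition (H): there are $M>0$ and $q\in(0,1)$ such that a random variable $\xi$ with law $\mu$ satisfies $$\sup_{u\in\mathbb{R}}\mathbb{P}(|\xi-u|\le 1)\le 1-q\qquad\text{and}\qquad \mathbb{P}(|\xi|>M)\le q/2.$$ Then there are a constant $C>0$ and a real sequence $o(1)$ (that is, a sequence indexed by $n$ that tends to $0$ as $n\to\infty$), both depending only on $\mu$, such that the following holds. Let $\xi_0,\xi_1,\xi_2,\dots$ be independent real random variables with common law $\mu$, and for $n\ge 1$ let $\mathcal{C}_n$ be the $n\times n$ circulant matrix with first row $(\xi_0,\xi_1,\dots,\xi_{n-1})$, i.e. with $(i,j)$ entry $\xi_{(j-i)\bmod n}$, and let $\sigma_{\min}(\mathcal{C}_n)$ be its smallest singular value (the square root of the smallest eigenvalue of $\mathcal{C}_n^{T}\mathcal{C}_n$). Then for every $\varepsilon>0$ and every $\rho\in(0,1/4)$, for all sufficiently large $n$, $$\mathbb{P}\bigl(\sigma_{\min}(\mathcal{C}_n)\le \varepsilon n^{-\rho}\bigr)\le C\left(\frac{\varepsilon^2+\varepsilon}{n^{2\rho}}+\frac{1}{n^{1/2-o(1)}}\right).$$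 -/

import Mathlib

open MeasureTheory ProbabilityTheory Filter Topology
open scoped ENNReal

/-- Condition (H) for the law `μ` of a real random variable `ξ`: for some `M > 0` and `q ∈ (0,1)`,
`sup_u P(|ξ - u| ≤ 1) ≤ 1 - q` and `P(|ξ| > M) ≤ q / 2`. -/
def ConditionH (μ : Measure ℝ) : Prop :=
  ∃ M q : ℝ, 0 < M ∧ 0 < q ∧ q < 1 ∧
    (⨆ u : ℝ, μ {x | |x - u| ≤ 1}) ≤ ENNReal.ofReal (1 - q) ∧
    μ {x | |x| > M} ≤ ENNReal.ofReal (q / 2)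

/-- The `n × n` circulant matrix with first row `(x 0, …, x (n - 1))`: its `(i, j)` entry is
`x ((j - i) mod n)`. (Mathlib's `Matrix.circulant` prescribes the first column.) -/
def rowCirculant (n : ℕ) (x : ℕ → ℝ) : Matrix (Fin n) (Fin n) ℝ :=
  (Matrix.circulant fun k : Fin n => x k).transpose

/-- The smallest singular value of a square real matrix `A`, that is, the last of the `n` square
roots of the eigenvalues of `Aᵀ A` listed in decreasing order. (Singular values are indexed from
`0`; the value for the `0 × 0` matrix is irrelevant.) -/
noncomputable def sigmaMin {n : ℕ} (A : Matrix (Fin n) (Fin n) ℝ) : ℝ :=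
  (Matrix.toEuclideanLin A).singularValues (n - 1)

/-!
The discrete Fourier transform diagonalises a circulant matrix, so `σ_min` is the modulus of some
Fourier mode `∑ j, ξ j • ψ j` of its first row, and a union bound over the characters `ψ` of
`ZMod n` reduces the theorem to small-ball estimates for these sums.

By Esseen's inequality the probability that such a sum is at most `t` is governed by its
characteristic function on `‖η‖ ≤ 1 / t`, which is at most
`exp (-(1/2) 𝔼 ∑ j, (1 - cos (ξ' ⟪ψ j, η⟫)))` with `ξ'` the symmetrised variable. For `ψ ^ 2 ≠ 1`,
orthogonality gives `∑ j, ⟪ψ j, w⟫ ^ 2 = n ‖w‖ ^ 2 / 2`, hence Gaussian decay as long as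
`w = ξ' η` stays bounded by `π`. For larger `w`, multiplying by the conjugate of `ψ h - 1` compares
`w` with a vector of norm of order one, provided that `ψ` takes values close enough to `1`, that is,
provided that its order is at least `2π‖w‖`. This yields the bound `O(t ^ 2 / n)` for all characters
of order at least a multiple of `1 / t`. Only `O(t ^ (-2))` characters have smaller order, which is
`O(√n)` for `t ≥ n ^ (-1/4)`, and each of them contributes `O(1 / n)`. The at most two characters
with `ψ ^ 2 = 1` give real sums and contribute `O(1 / √n)`.
-/

section Symmetrization

variable {E : Type*} [NormedAddCommGroup E] [MeasurableSpace E] [BorelSpace E]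
  [SecondCountableTopology E]

/-- The law of `X - X'`, where `X` and `X'` are independent with law `μ`. -/
noncomputable def symmetrization (μ : Measure E) : Measure E :=
  (μ.prod μ).map fun p => p.1 - p.2

instance (μ : Measure E) [IsProbabilityMeasure μ] : IsProbabilityMeasure (symmetrization μ) :=
  Measure.isProbabilityMeasure_map (by fun_prop)

theorem symmetrization_compl_zero_ne_zero {μ : Measure E} [IsProbabilityMeasure μ]
    (hμ : ∀ a, μ ≠ Measure.dirac a) : symmetrization μ {0}ᶜ ≠ 0 := by
  intro h
  have h_diag : ∀ᵐ p ∂(μ.prod μ), p.1 - p.2 = 0 :=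
    ae_of_ae_map (f := fun p : E × E => p.1 - p.2) (p := (· = 0)) (by fun_prop) h
  obtain ⟨a, ha⟩ := (Measure.ae_ae_of_ae_prod h_diag).exists
  have ha_one : μ {a} = 1 := (prob_compl_eq_zero_iff (measurableSet_singleton a)).1
    (ha.mono fun y hy => (sub_eq_zero.1 hy).symm)
  refine hμ a ?_
  simpa [ha_one] using (Measure.ae_mem_finset_iff (μ := μ) (s := {a})).1
    (ha.mono fun y hy => Finset.mem_singleton.2 (sub_eq_zero.1 hy).symm)

theorem exists_symmetrization_annulus_pos {μ : Measure E} [IsProbabilityMeasure μ]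
    (hμ : ∀ a, μ ≠ Measure.dirac a) :
    ∃ δ Λ : ℝ, 0 < δ ∧ 0 < Λ ∧ 0 < (symmetrization μ).real {x | ‖x‖ ∈ Set.Icc δ Λ} := by
  have h_union :
      symmetrization μ (⋃ m : ℕ, {x | ‖x‖ ∈ Set.Icc (1 / (m + 1 : ℝ)) (m + 1)}) ≠ 0 := by
    refine fun h => symmetrization_compl_zero_ne_zero hμ (measure_mono_null (fun x hx => ?_) h)
    obtain ⟨m, hm⟩ := exists_nat_ge (max ‖x‖ (1 / ‖x‖))
    have hx_pos : 0 < ‖x‖ := norm_pos_iff.2 hx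
    refine Set.mem_iUnion.2 ⟨m, (one_div_le hx_pos (by positivity)).1 ?_, ?_⟩
    · linarith [le_max_right ‖x‖ (1 / ‖x‖)]
    · linarith [le_max_left ‖x‖ (1 / ‖x‖)]
  obtain ⟨m, hm⟩ := exists_measure_pos_of_not_measure_iUnion_null h_union
  exact ⟨1 / (m + 1), m + 1, by positivity, by positivity,
    ENNReal.toReal_pos hm.ne' (measure_ne_top _ _)⟩

variable [InnerProductSpace ℝ E] (μ : Measure E) [IsProbabilityMeasure μ] (η : E)

theorem charFun_symmetrization :
    charFun (symmetrization μ) η = ((‖charFun μ η‖ ^ 2 : ℝ) : ℂ) := by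
  rw [symmetrization, charFun_apply, integral_map (by fun_prop) (by fun_prop)]
  push_cast
  rw [← Complex.mul_conj', ← charFun_neg, charFun_apply, charFun_apply, ← integral_prod_mul]
  refine integral_congr_ae (ae_of_all _ fun p => ?_)
  simp only [← Complex.exp_add, inner_sub_left, inner_neg_right]
  push_cast
  ring_nf

theorem integrable_one_sub_cos_inner (ν : Measure E) [IsFiniteMeasure ν] :
    Integrable (fun x => 1 - Real.cos (inner ℝ x η)) ν :=
  (integrable_const 1).sub
    (.of_bound (C := 1) (by fun_prop) (ae_of_all _ fun _ => Real.abs_cos_le_one _))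

theorem norm_charFun_sq_eq_integral_cos :
    ‖charFun μ η‖ ^ 2 = ∫ x, Real.cos (inner ℝ x η) ∂(symmetrization μ) := by
  have h_int : Integrable (fun x => Complex.exp (inner ℝ x η * Complex.I)) (symmetrization μ) :=
    .of_bound (C := 1) (by fun_prop) (ae_of_all _ fun _ => (Complex.norm_exp_ofReal_mul_I _).le)
  have h_re := congrArg Complex.re (charFun_symmetrization μ η)
  rw [Complex.ofReal_re, charFun_apply] at h_re
  rw [← h_re]
  refine (integral_re h_int).symm.trans ?_
  simp_rw [← Complex.exp_ofReal_mul_I_re]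
  rfl

theorem norm_charFun_le_exp_integral_one_sub_cos :
    ‖charFun μ η‖ ≤
      Real.exp (-(1 / 2) * ∫ x, (1 - Real.cos (inner ℝ x η)) ∂(symmetrization μ)) := by
  have h_int : Integrable (fun x => Real.cos (inner ℝ x η)) (symmetrization μ) :=
    .of_bound (C := 1) (by fun_prop) (ae_of_all _ fun _ => Real.abs_cos_le_one _)
  rw [integral_sub (integrable_const _) h_int, ← norm_charFun_sq_eq_integral_cos, integral_const,
    probReal_univ, one_smul]
  refine le_of_sq_le_sq ?_ (Real.exp_nonneg _)
  rw [← Real.exp_nat_mul]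
  calc ‖charFun μ η‖ ^ 2 = (‖charFun μ η‖ ^ 2 - 1) + 1 := by ring
    _ ≤ Real.exp (‖charFun μ η‖ ^ 2 - 1) := Real.add_one_le_exp _
    _ = _ := by push_cast; ring_nf

end Symmetrization

section Esseen

variable {E : Type*} [NormedAddCommGroup E] [InnerProductSpace ℝ E] [FiniteDimensional ℝ E]
  [MeasurableSpace E] [BorelSpace E]

theorem integral_charFun_comm (κ ν : Measure E) [IsFiniteMeasure κ] [IsFiniteMeasure ν] :
    ∫ x, charFun κ x ∂ν = ∫ u, charFun ν u ∂κ := by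
  simp only [charFun_apply]
  rw [integral_integral_swap]
  · simp_rw [real_inner_comm]
  · refine .of_bound (C := 1) (by fun_prop) (ae_of_all _ fun p => ?_)
    exact (Complex.norm_exp_ofReal_mul_I _).le

theorem half_le_norm_charFun {κ : Measure E} [IsProbabilityMeasure κ] {t : ℝ} (ht : 0 < t)
    (hκ : ∀ᵐ u ∂κ, ‖u‖ ≤ 1 / (2 * t)) {x : E} (hx : ‖x‖ ≤ t) : 1 / 2 ≤ ‖charFun κ x‖ := by
  have h_int : Integrable (fun u => Complex.exp (inner ℝ u x * Complex.I)) κ :=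
    .of_bound (C := 1) (by fun_prop) (ae_of_all _ fun _ => (Complex.norm_exp_ofReal_mul_I _).le)
  have h_near_one : ‖1 - charFun κ x‖ ≤ 1 / 2 := by
    have h_diff : charFun κ x - 1 = ∫ u, (Complex.exp (inner ℝ u x * Complex.I) - 1) ∂κ := by
      rw [integral_sub h_int (integrable_const _), charFun_apply, integral_const, probReal_univ,
        one_smul]
    rw [norm_sub_rev, h_diff]
    refine (norm_integral_le_of_norm_le_const (C := 1 / 2) ?_).trans (by simp)
    filter_upwards [hκ] with u hu
    calc ‖Complex.exp (inner ℝ u x * Complex.I) - 1‖ ≤ ‖inner ℝ u x‖ := by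
          rw [mul_comm]
          exact Real.norm_exp_I_mul_ofReal_sub_one_le
      _ ≤ ‖u‖ * ‖x‖ := norm_inner_le_norm u x
      _ ≤ 1 / (2 * t) * t := by gcongr
      _ = 1 / 2 := by field_simp
  have h_one : (1 : ℝ) ≤ ‖1 - charFun κ x‖ + ‖charFun κ x‖ := by
    simpa using norm_add_le (1 - charFun κ x) (charFun κ x)
  linarith

theorem measureReal_closedBall_le_integral_symmetrization (κ ν : Measure E)
    [IsProbabilityMeasure κ] [IsProbabilityMeasure ν] {t : ℝ} (ht : 0 < t)
    (hκ : ∀ᵐ u ∂κ, ‖u‖ ≤ 1 / (2 * t)) :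
    ν.real (Metric.closedBall 0 t) ≤ 4 * ∫ u, ‖charFun ν u‖ ∂(symmetrization κ) := by
  have h_lower : ν.real (Metric.closedBall 0 t) / 4 ≤ ∫ x, ‖charFun κ x‖ ^ 2 ∂ν := by
    calc ν.real (Metric.closedBall 0 t) / 4
        = ∫ x, (Metric.closedBall 0 t).indicator (fun _ => (1 / 4 : ℝ)) x ∂ν := by
          rw [integral_indicator_const _ measurableSet_closedBall, smul_eq_mul]; ring
      _ ≤ ∫ x, ‖charFun κ x‖ ^ 2 ∂ν := by
          refine integral_mono ((integrable_const _).indicator measurableSet_closedBall)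
            (.of_bound (C := 1) (measurable_charFun.norm.pow_const 2).aestronglyMeasurable
              (ae_of_all _ fun x => ?_)) (Set.indicator_le' (fun x hx => ?_) fun x _ => ?_)
          · simpa using norm_charFun_le_one x
          · nlinarith [half_le_norm_charFun ht hκ (mem_closedBall_zero_iff.1 hx)]
          · positivity
  have h_duality : ∫ x, ‖charFun κ x‖ ^ 2 ∂ν ≤ ∫ u, ‖charFun ν u‖ ∂(symmetrization κ) := by
    refine le_trans ?_ (norm_integral_le_integral_norm _)
    rw [← integral_charFun_comm]
    simp_rw [charFun_symmetrization]
    rw [integral_complex_ofReal, Complex.norm_real]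
    exact le_abs_self _
  linarith

theorem symmetrization_cond_ball_le {r : ℝ} (hr : 0 < r) :
    symmetrization (ProbabilityTheory.cond volume (Metric.ball (0 : E) r)) ≤
      (volume (Metric.ball (0 : E) r))⁻¹ • volume.restrict (Metric.ball (0 : E) (2 * r)) := by
  set B := Metric.ball (0 : E) r
  have : IsProbabilityMeasure (ProbabilityTheory.cond volume B) :=
    cond_isProbabilityMeasure_of_finite (Metric.measure_ball_pos _ _ hr).ne' measure_ball_lt_top.ne
  refine Measure.le_iff.2 fun s hs => ?_
  set T := s ∩ Metric.ball (0 : E) (2 * r)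
  have hT : MeasurableSet T := hs.inter measurableSet_ball
  have h_slice : ∀ u ∈ B, ProbabilityTheory.cond volume B ((u - ·) ⁻¹' s) ≤
      (volume B)⁻¹ * volume T := by
    intro u hu
    rw [cond_apply measurableSet_ball,
      ← (Measure.measurePreserving_sub_left volume u).measure_preimage hT.nullMeasurableSet]
    gcongr
    intro v hv
    refine ⟨hv.2, mem_ball_zero_iff.2 ((norm_sub_le u v).trans_lt ?_)⟩
    linarith [mem_ball_zero_iff.1 hu, mem_ball_zero_iff.1 hv.1]
  rw [symmetrization, Measure.map_apply (by fun_prop) hs, Measure.prod_apply (measurable_sub hs),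
    Measure.smul_apply, Measure.restrict_apply hs, smul_eq_mul]
  calc ∫⁻ u, ProbabilityTheory.cond volume B ((u - ·) ⁻¹' s) ∂(ProbabilityTheory.cond volume B)
      ≤ ∫⁻ _, (volume B)⁻¹ * volume T ∂(ProbabilityTheory.cond volume B) :=
        lintegral_mono_ae ((ae_cond_mem measurableSet_ball).mono h_slice)
    _ = (volume B)⁻¹ * volume T := by rw [lintegral_const, measure_univ, mul_one]

theorem integrable_norm_charFun (ν κ : Measure E) [IsProbabilityMeasure ν] [IsFiniteMeasure κ] :
    Integrable (fun η => ‖charFun ν η‖) κ :=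
  .of_bound (C := 1) measurable_charFun.norm.aestronglyMeasurable
    (ae_of_all _ fun η => by simpa using norm_charFun_le_one η)

theorem measureReal_closedBall_le_integral_norm_charFun (ν : Measure E) [IsProbabilityMeasure ν]
    {t : ℝ} (ht : 0 < t) :
    ν.real (Metric.closedBall 0 t) ≤ 4 * ((volume.real (Metric.ball (0 : E) (1 / (2 * t))))⁻¹ *
      ∫ η in Metric.ball 0 (1 / t), ‖charFun ν η‖) := by
  have hr : 0 < 1 / (2 * t) := by positivity
  have hB : (volume (Metric.ball (0 : E) (1 / (2 * t)))) ≠ 0 :=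
    (Metric.measure_ball_pos _ _ hr).ne'
  have := cond_isProbabilityMeasure_of_finite hB measure_ball_lt_top.ne
  have := isFiniteMeasure_restrict.2
    (measure_ball_lt_top (μ := volume) (x := (0 : E)) (r := 1 / t)).ne
  have h_supp : ∀ᵐ u ∂(ProbabilityTheory.cond volume (Metric.ball (0 : E) (1 / (2 * t)))),
      ‖u‖ ≤ 1 / (2 * t) :=
    (ae_cond_mem measurableSet_ball).mono fun u hu => (mem_ball_zero_iff.1 hu).le
  have h_dom := symmetrization_cond_ball_le (E := E) hr
  rw [show 2 * (1 / (2 * t)) = 1 / t by field_simp] at h_dom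
  refine (measureReal_closedBall_le_integral_symmetrization _ ν ht h_supp).trans ?_
  gcongr
  refine (integral_mono_measure h_dom (ae_of_all _ fun _ => norm_nonneg _)
    ((integrable_norm_charFun ν _).smul_measure (ENNReal.inv_ne_top.2 hB))).trans_eq ?_
  rw [integral_smul_measure, ENNReal.toReal_inv, smul_eq_mul, measureReal_def]

theorem measureReal_closedBall_le_of_norm_charFun_le (ν : Measure E)
    [IsProbabilityMeasure ν] {t a b : ℝ} (ht : 0 < t) (ha : 0 < a)
    (h : ∀ η : E, ‖η‖ ≤ 1 / t → ‖charFun ν η‖ ≤ Real.exp (-a * ‖η‖ ^ 2) + b) :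
    ν.real (Metric.closedBall 0 t) ≤
      4 * ((2 * t) ^ (Module.finrank ℝ E) / (volume : Measure E).real (Metric.ball 0 1) *
        (Real.pi / a) ^ (Module.finrank ℝ E / 2 : ℝ) + 2 ^ (Module.finrank ℝ E) * b) := by
  set d := Module.finrank ℝ E
  set V := (volume : Measure E).real (Metric.ball 0 1)
  have h_vol (r : ℝ) (hr : 0 < r) : (volume : Measure E).real (Metric.ball 0 r) = r ^ d * V := by
    rw [measureReal_def, Measure.addHaar_ball_of_pos _ _ hr, ENNReal.toReal_mul,
      ENNReal.toReal_ofReal (by positivity)]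
    rfl
  have hV : 0 < V :=
    ENNReal.toReal_pos (Metric.measure_ball_pos _ _ one_pos).ne' measure_ball_lt_top.ne
  have := isFiniteMeasure_restrict.2
    (measure_ball_lt_top (μ := volume) (x := (0 : E)) (r := 1 / t)).ne
  have h_gauss : Integrable fun η : E => Real.exp (-a * ‖η‖ ^ 2) := by
    refine .of_integral_ne_zero ?_
    rw [GaussianFourier.integral_rexp_neg_mul_sq_norm ha]
    positivity
  have h_integral : ∫ η in Metric.ball 0 (1 / t), ‖charFun ν η‖ ≤
      (Real.pi / a) ^ (d / 2 : ℝ) + (1 / t) ^ d * V * b := by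
    calc ∫ η in Metric.ball 0 (1 / t), ‖charFun ν η‖
        ≤ ∫ η in Metric.ball (0 : E) (1 / t), (Real.exp (-a * ‖η‖ ^ 2) + b) := by
          refine setIntegral_mono_on (integrable_norm_charFun ν _)
            (h_gauss.integrableOn.add (integrable_const b)) measurableSet_ball fun η hη => ?_
          exact h η (mem_ball_zero_iff.1 hη).le
      _ = (∫ η in Metric.ball (0 : E) (1 / t), Real.exp (-a * ‖η‖ ^ 2)) + (1 / t) ^ d * V * b := by
          rw [integral_add h_gauss.integrableOn (integrable_const b), setIntegral_const,
            h_vol _ (by positivity), smul_eq_mul]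
      _ ≤ (Real.pi / a) ^ (d / 2 : ℝ) + (1 / t) ^ d * V * b := by
          rw [← GaussianFourier.integral_rexp_neg_mul_sq_norm ha]
          exact add_le_add_left
            (setIntegral_le_integral h_gauss (ae_of_all _ fun _ => Real.exp_nonneg _)) _
  refine (measureReal_closedBall_le_integral_norm_charFun ν ht).trans ?_
  gcongr
  rw [h_vol _ (by positivity)]
  refine (mul_le_mul_of_nonneg_left h_integral (by positivity)).trans_eq ?_
  simp only [div_pow, mul_pow, one_pow]
  field_simp

end Esseen

section RandomSum

variable {ι : Type*} [Fintype ι] {E : Type*} [NormedAddCommGroup E] [InnerProductSpace ℝ E]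

/-- How far the linear functional `⟪·, w⟫` is from taking values in `2πℤ` on the vectors `v i`,
measured by `1 - cos`. It controls the characteristic function of `∑ i, X i • v i`, where the `X i`
are independent and identically distributed. -/
noncomputable def cosDefect (v : ι → E) (w : E) : ℝ :=
  ∑ i, (1 - Real.cos (inner ℝ (v i) w))

theorem cosDefect_nonneg (v : ι → E) (w : E) : 0 ≤ cosDefect v w :=
  Finset.sum_nonneg fun _ _ => sub_nonneg.2 (Real.cos_le_one _)

theorem cosDefect_smul (v : ι → E) (x : ℝ) (w : E) :
    cosDefect v (x • w) = ∑ i, (1 - Real.cos (inner ℝ x (inner ℝ (v i) w))) := by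
  simp only [cosDefect, real_inner_smul_right, Real.inner_apply]

theorem integrable_cosDefect_smul (v : ι → E) (w : E) (ν : Measure ℝ) [IsFiniteMeasure ν] :
    Integrable (fun x : ℝ => cosDefect v (x • w)) ν := by
  simp only [cosDefect_smul]
  exact integrable_finsetSum _ fun i _ => integrable_one_sub_cos_inner _ _

variable [MeasurableSpace E] [BorelSpace E] [FiniteDimensional ℝ E]
  {Ω : Type*} [MeasurableSpace Ω] {P : Measure Ω} {μ : Measure ℝ} {X : ι → Ω → ℝ}

theorem charFun_map_sum_smul (hind : iIndepFun X P) (hlaw : ∀ i, HasLaw (X i) μ P)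
    (v : ι → E) (η : E) :
    charFun (P.map fun ω => ∑ i, X i ω • v i) η = ∏ i, charFun μ (inner ℝ (v i) η) := by
  have h_meas (i : ι) : AEMeasurable (fun ω => X i ω • v i) P :=
    (hlaw i).aemeasurable.smul_const _
  rw [(hind.comp (fun i x => x • v i) (by fun_prop)).charFun_map_fun_sum_eq_prod h_meas,
    Finset.prod_apply]
  refine Finset.prod_congr rfl fun i _ => ?_
  rw [charFun_apply, integral_map (h_meas i) (by fun_prop), charFun_apply_real,
    ← (hlaw i).map_eq, integral_map (hlaw i).aemeasurable (by fun_prop)]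
  simp only [real_inner_smul_left, Complex.ofReal_mul, mul_comm]

variable [IsProbabilityMeasure μ]

theorem norm_charFun_map_sum_smul_le_exp_integral_cosDefect (hind : iIndepFun X P)
    (hlaw : ∀ i, HasLaw (X i) μ P) (v : ι → E) (η : E) :
    ‖charFun (P.map fun ω => ∑ i, X i ω • v i) η‖ ≤
      Real.exp (-(1 / 2) * ∫ x, cosDefect v (x • η) ∂(symmetrization μ)) := by
  simp only [cosDefect_smul]
  rw [charFun_map_sum_smul hind hlaw, norm_prod,
    integral_finsetSum _ fun i _ => integrable_one_sub_cos_inner _ _, Finset.mul_sum, Real.exp_sum]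
  exact Finset.prod_le_prod (fun _ _ => norm_nonneg _) fun i _ =>
    norm_charFun_le_exp_integral_one_sub_cos μ _

theorem norm_charFun_map_sum_smul_le (hind : iIndepFun X P) (hlaw : ∀ i, HasLaw (X i) μ P)
    (v : ι → E) {δ Λ κ t A b : ℝ} (hδ : 0 < δ)
    (hκ : κ ≤ (symmetrization μ).real {x | ‖x‖ ∈ Set.Icc δ Λ}) (hA : 0 < A) (hb : 0 < b)
    (hv : ∀ w, ‖w‖ ≤ Λ / t → min (A * ‖w‖ ^ 2) b ≤ cosDefect v w) {η : E} (hη : ‖η‖ ≤ 1 / t) :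
    ‖charFun (P.map fun ω => ∑ i, X i ω • v i) η‖ ≤
      Real.exp (-(κ * A * δ ^ 2 / 2) * ‖η‖ ^ 2) + Real.exp (-(κ * b / 2)) := by
  set m := min (A * (δ * ‖η‖) ^ 2) b
  have : 0 ≤ m := by positivity
  have h_annulus : {x : ℝ | ‖x‖ ∈ Set.Icc δ Λ} ⊆ {x | m ≤ cosDefect v (x • η)} := by
    intro x hx
    have h_scale : ‖x • η‖ ≤ Λ / t := by
      rw [norm_smul, div_eq_mul_one_div]
      exact mul_le_mul hx.2 hη (norm_nonneg _) ((norm_nonneg x).trans hx.2)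
    refine le_trans ?_ (hv _ h_scale)
    rw [norm_smul]
    refine min_le_min_right _ ?_
    gcongr
    exact hx.1
  have h_markov : κ * m ≤ ∫ x, cosDefect v (x • η) ∂(symmetrization μ) := by
    refine le_trans ?_ (mul_meas_ge_le_integral_of_nonneg
      (ae_of_all _ fun x => cosDefect_nonneg v _) (integrable_cosDefect_smul v η _) m)
    rw [mul_comm]
    gcongr
    exact hκ.trans (measureReal_mono h_annulus)
  refine (norm_charFun_map_sum_smul_le_exp_integral_cosDefect hind hlaw v η).trans ?_
  calc Real.exp (-(1 / 2) * ∫ x, cosDefect v (x • η) ∂(symmetrization μ))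
      ≤ Real.exp (-(κ * m / 2)) := Real.exp_le_exp.2 (by linarith)
    _ ≤ _ := by
      rcases min_choice (A * (δ * ‖η‖) ^ 2) b with h | h <;> rw [show m = _ from h]
      · refine le_add_of_le_of_nonneg (Real.exp_le_exp.2 (by linarith)) (Real.exp_nonneg _)
      · exact le_add_of_nonneg_left (Real.exp_nonneg _)

theorem measureReal_norm_sum_smul_le [IsProbabilityMeasure P] (hind : iIndepFun X P)
    (hlaw : ∀ i, HasLaw (X i) μ P) (v : ι → E) {δ Λ κ t A b : ℝ} (hδ : 0 < δ) (hκ_pos : 0 < κ)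
    (hκ : κ ≤ (symmetrization μ).real {x | ‖x‖ ∈ Set.Icc δ Λ}) (ht : 0 < t) (hA : 0 < A)
    (hb : 0 < b) (hv : ∀ w, ‖w‖ ≤ Λ / t → min (A * ‖w‖ ^ 2) b ≤ cosDefect v w) :
    P.real {ω | ‖∑ i, X i ω • v i‖ ≤ t} ≤
      4 * ((2 * t) ^ Module.finrank ℝ E / (volume : Measure E).real (Metric.ball 0 1) *
        (Real.pi / (κ * A * δ ^ 2 / 2)) ^ (Module.finrank ℝ E / 2 : ℝ) +
        2 ^ Module.finrank ℝ E * Real.exp (-(κ * b / 2))) := by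
  have hm : AEMeasurable (fun ω => ∑ i, X i ω • v i) P :=
    Finset.aemeasurable_fun_sum _ fun i _ => (hlaw i).aemeasurable.smul_const _
  have := Measure.isProbabilityMeasure_map hm
  convert! measureReal_closedBall_le_of_norm_charFun_le (P.map fun ω => ∑ i, X i ω • v i) ht
    (a := κ * A * δ ^ 2 / 2) (by positivity) fun η hη =>
      norm_charFun_map_sum_smul_le hind hlaw v hδ hκ hA hb hv hη
  rw [map_measureReal_apply_of_aemeasurable hm measurableSet_closedBall]
  simp only [Set.preimage, mem_closedBall_zero_iff]

end RandomSum

section CosDefect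

variable {ι E : Type*} [Fintype ι] [NormedAddCommGroup E] [InnerProductSpace ℝ E]

theorem two_div_pi_sq_mul_sum_inner_sq_le_cosDefect {v : ι → E} (hv : ∀ i, ‖v i‖ ≤ 1) {w : E}
    (hw : ‖w‖ ≤ Real.pi) : 2 / Real.pi ^ 2 * ∑ i, inner ℝ (v i) w ^ 2 ≤ cosDefect v w := by
  rw [cosDefect, Finset.mul_sum]
  gcongr with i
  have h_abs : |inner ℝ (v i) w| ≤ Real.pi :=
    (abs_real_inner_le_norm _ _).trans
      ((mul_le_of_le_one_left (norm_nonneg _) (hv i)).trans hw)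
  linarith [Real.cos_le_one_sub_mul_cos_sq h_abs]

theorem one_sub_cos_sub_le (a b : ℝ) :
    1 - Real.cos (a - b) ≤ 2 * ((1 - Real.cos a) + (1 - Real.cos b)) := by
  rw [Real.cos_sub]
  nlinarith [sq_nonneg (Real.cos a + Real.cos b - 2), sq_nonneg (Real.sin a + Real.sin b),
    Real.sin_sq_add_cos_sq a, Real.sin_sq_add_cos_sq b]

variable {G : Type*} [AddCommGroup G] [Fintype G] {ψ : AddChar G ℂ} {w : ℂ}

theorem sum_addChar_inner_sq (hψ : ψ ^ 2 ≠ 1) (w : ℂ) :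
    ∑ g, inner ℝ (ψ g) w ^ 2 = Fintype.card G * ‖w‖ ^ 2 / 2 := by
  have h_term (g : G) :
      inner ℝ (ψ g) w ^ 2 = (‖w‖ ^ 2 + (starRingEnd ℂ ((ψ ^ 2) g) * w ^ 2).re) / 2 := by
    have h_re_sq (u : ℂ) : u.re ^ 2 = (‖u‖ ^ 2 + (u ^ 2).re) / 2 := by
      rw [Complex.sq_norm, Complex.normSq_apply, sq u, Complex.mul_re]
      ring
    rw [Complex.inner, h_re_sq, norm_mul, RCLike.norm_conj, ψ.norm_apply, mul_one, mul_pow,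
      AddChar.pow_apply, map_pow, mul_comm (w ^ 2)]
  simp_rw [h_term]
  rw [← Finset.sum_div, Finset.sum_add_distrib, ← Complex.re_sum, ← Finset.sum_mul, ← map_sum,
    AddChar.sum_eq_zero_iff_ne_zero.2 hψ]
  simp

theorem cosDefect_addChar_ge_of_norm_le_pi (hψ : ψ ^ 2 ≠ 1) (hw : ‖w‖ ≤ Real.pi) :
    Fintype.card G / Real.pi ^ 2 * ‖w‖ ^ 2 ≤ cosDefect ψ w := by
  have h := two_div_pi_sq_mul_sum_inner_sq_le_cosDefect (fun g => (ψ.norm_apply g).le) hw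
  rw [sum_addChar_inner_sq hψ] at h
  exact h.trans_eq' (by ring)

/-- Multiplication by `ψ h` permutes the values of `ψ`, so the defect at `(ψ h - 1)‾ * w` compares
the defect at `w` with itself. -/
theorem cosDefect_addChar_conj_mul_le (h : G) (w : ℂ) :
    cosDefect ψ (starRingEnd ℂ (ψ h - 1) * w) ≤ 4 * cosDefect ψ w := by
  have h_inner (g : G) : inner ℝ (ψ g) (starRingEnd ℂ (ψ h - 1) * w) =
      inner ℝ (ψ (g + h)) w - inner ℝ (ψ g) w := by
    simp only [Complex.inner, AddChar.map_add_eq_mul, map_sub, map_mul, map_one, ← Complex.sub_re]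
    congr 1
    ring
  have h_shift : ∑ g, (1 - Real.cos (inner ℝ (ψ (g + h)) w)) = cosDefect ψ w :=
    Equiv.sum_comp (Equiv.addRight h) fun g => 1 - Real.cos (inner ℝ (ψ g) w)
  calc cosDefect ψ (starRingEnd ℂ (ψ h - 1) * w)
      ≤ ∑ g, 2 * ((1 - Real.cos (inner ℝ (ψ (g + h)) w)) + (1 - Real.cos (inner ℝ (ψ g) w))) := by
        simp only [cosDefect, h_inner]
        gcongr with g
        exact one_sub_cos_sub_le _ _
    _ = 4 * cosDefect ψ w := by
        rw [← Finset.mul_sum, Finset.sum_add_distrib, h_shift, cosDefect]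
        ring

theorem norm_exp_I_mul_sub_one_mem_Icc {θ : ℝ} (hθ : 0 ≤ θ) (hθπ : θ ≤ Real.pi) :
    ‖Complex.exp (Complex.I * θ) - 1‖ ∈ Set.Icc (2 / Real.pi * θ) θ := by
  constructor
  · rw [Complex.norm_exp_I_mul_ofReal_sub_one]
    refine le_trans ?_ (le_abs_self _)
    linarith [Real.mul_le_sin (x := θ / 2) (by linarith) (by linarith)]
  · simpa [abs_of_nonneg hθ] using Real.norm_exp_I_mul_ofReal_sub_one_le (x := θ)

theorem natFloor_div_mem_Icc {x : ℝ} (hx : 1 ≤ x) : ⌊x⌋₊ / x ∈ Set.Icc (1 / 2) 1 := by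
  have h_one : (1 : ℝ) ≤ ⌊x⌋₊ := by exact_mod_cast (Nat.one_le_floor_iff x).2 hx
  constructor
  · rw [le_div_iff₀ (by linarith)]
    linarith [Nat.lt_floor_add_one x]
  · exact (div_le_one (by linarith)).2 (Nat.floor_le (by linarith))

theorem exists_norm_pow_sub_one_mem_Icc {ζ : ℂ} {m : ℕ} (hζ : IsPrimitiveRoot ζ m)
    {R : ℝ} (hR : 1 ≤ R) (hRm : 2 * Real.pi * R ≤ m) :
    ∃ j : ℕ, ‖ζ ^ j - 1‖ ∈ Set.Icc (1 / (Real.pi * R)) (1 / R) := by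
  have hπ := Real.pi_gt_three
  have hm : (0 : ℝ) < m := lt_of_lt_of_le (by positivity) hRm
  have : NeZero m := ⟨by exact_mod_cast hm.ne'⟩
  -- An angle of `⌊D⌋` steps of size `2π / m` lies in `[1 / (2R), 1 / R]`, as `⌊D⌋ / D ∈ [1/2, 1]`.
  set D : ℝ := m / (2 * Real.pi * R) with hD
  have hD_one : 1 ≤ D := (one_le_div (by positivity)).2 hRm
  obtain ⟨h_floor_ge, h_floor_le⟩ := natFloor_div_mem_Icc hD_one
  set a := ⌊D⌋₊
  set θ : ℝ := 2 * Real.pi * a / m with hθ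
  have hθ_eq : θ = a / D / R := by
    rw [hθ, hD]
    field_simp
  have hθ_le : θ ≤ 1 / R := by
    rw [hθ_eq]
    gcongr
  have hθ_ge : 1 / 2 / R ≤ θ := by
    rw [hθ_eq]
    exact div_le_div_of_nonneg_right h_floor_ge (by linarith)
  have hθ_pi : θ ≤ Real.pi := by
    linarith [(div_le_one (by linarith : 0 < R)).2 hR]
  obtain ⟨j, -, hj⟩ := hζ.eq_pow_of_pow_eq_one (ξ := Complex.exp (Complex.I * θ)) (by
    rw [← Complex.exp_nat_mul, Complex.exp_eq_one_iff]
    refine ⟨a, ?_⟩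
    have : (m : ℂ) ≠ 0 := by exact_mod_cast hm.ne'
    simp only [hθ]
    push_cast
    field_simp)
  have h_mem := norm_exp_I_mul_sub_one_mem_Icc ((by positivity : 0 ≤ 1 / 2 / R).trans hθ_ge) hθ_pi
  rw [← hj] at h_mem
  refine ⟨j, le_trans ?_ h_mem.1, h_mem.2.trans hθ_le⟩
  calc 1 / (Real.pi * R) = 2 / Real.pi * (1 / 2 / R) := by field_simp
    _ ≤ 2 / Real.pi * θ := by gcongr

theorem cosDefect_addChar_ge_of_one_le_norm (hψ : ψ ^ 2 ≠ 1) {g₀ : G} {m : ℕ}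
    (hm : IsPrimitiveRoot (ψ g₀) m) (hw : 1 ≤ ‖w‖) (hwm : 2 * Real.pi * ‖w‖ ≤ m) :
    Fintype.card G / (4 * Real.pi ^ 4) ≤ cosDefect ψ w := by
  have hw_pos : 0 < ‖w‖ := by linarith
  obtain ⟨j, hj_ge, hj_le⟩ := exists_norm_pow_sub_one_mem_Icc hm hw hwm
  rw [← AddChar.map_nsmul_eq_pow] at hj_ge hj_le
  set w' := starRingEnd ℂ (ψ (j • g₀) - 1) * w
  have h_norm : ‖w'‖ = ‖ψ (j • g₀) - 1‖ * ‖w‖ := by rw [norm_mul, RCLike.norm_conj]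
  have h_le : ‖w'‖ ≤ 1 := by
    rw [h_norm]
    exact (le_div_iff₀ hw_pos).1 hj_le
  have h_ge : 1 / Real.pi ≤ ‖w'‖ := by
    rw [h_norm, ← div_le_iff₀ hw_pos, div_div]
    exact hj_ge
  have h_small : Fintype.card G / Real.pi ^ 2 * ‖w'‖ ^ 2 ≤ cosDefect ψ w' :=
    cosDefect_addChar_ge_of_norm_le_pi hψ (by linarith [Real.pi_gt_three])
  calc (Fintype.card G : ℝ) / (4 * Real.pi ^ 4)
      = Fintype.card G / Real.pi ^ 2 * (1 / Real.pi) ^ 2 / 4 := by field_simp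
    _ ≤ Fintype.card G / Real.pi ^ 2 * ‖w'‖ ^ 2 / 4 := by gcongr
    _ ≤ cosDefect ψ w := by linarith [cosDefect_addChar_conj_mul_le (ψ := ψ) (j • g₀) w]

theorem min_le_cosDefect_addChar (hψ : ψ ^ 2 ≠ 1) {g₀ : G} {m : ℕ}
    (hm : IsPrimitiveRoot (ψ g₀) m) (hw : ‖w‖ ≤ 1 ∨ 2 * Real.pi * ‖w‖ ≤ m) :
    min (Fintype.card G / Real.pi ^ 2 * ‖w‖ ^ 2) (Fintype.card G / (4 * Real.pi ^ 4)) ≤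
      cosDefect ψ w := by
  by_cases hw_one : ‖w‖ ≤ 1
  · exact min_le_of_left_le
      (cosDefect_addChar_ge_of_norm_le_pi hψ (by linarith [Real.pi_gt_three]))
  · exact min_le_of_right_le (cosDefect_addChar_ge_of_one_le_norm hψ hm (not_le.1 hw_one).le
      (hw.resolve_left hw_one))

end CosDefect

section SmallBall

variable {Ω : Type*} [MeasurableSpace Ω] {P : Measure Ω} [IsProbabilityMeasure P]
  {μ : Measure ℝ} [IsProbabilityMeasure μ] {δ Λ κ t : ℝ}

theorem measureReal_abs_sum_mul_sign_le {ι : Type*} [Fintype ι] [Nonempty ι] {X : ι → Ω → ℝ}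
    (hind : iIndepFun X P) (hlaw : ∀ i, HasLaw (X i) μ P) (hδ : 0 < δ) (hκ_pos : 0 < κ)
    (hκ : κ ≤ (symmetrization μ).real {x | ‖x‖ ∈ Set.Icc δ Λ}) (ht : 0 < t) (hΛt : Λ ≤ t)
    {s : ι → ℝ} (hs : ∀ i, |s i| = 1) :
    P.real {ω | |∑ i, X i ω * s i| ≤ t} ≤
      4 * t * √(Real.pi ^ 3 / (κ * δ ^ 2 * Fintype.card ι)) +
        8 * Real.exp (-(κ * Fintype.card ι / Real.pi ^ 2)) := by
  have : (0 : ℝ) < Fintype.card ι := by exact_mod_cast Fintype.card_pos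
  set A : ℝ := 2 * Fintype.card ι / Real.pi ^ 2 with hA
  have h_defect (w : ℝ) (hw : ‖w‖ ≤ Λ / t) : min (A * ‖w‖ ^ 2) A ≤ cosDefect s w := by
    have hw_pi : ‖w‖ ≤ Real.pi := by
      linarith [hw.trans ((div_le_one ht).2 hΛt), Real.pi_gt_three]
    refine min_le_of_left_le
      ((two_div_pi_sq_mul_sum_inner_sq_le_cosDefect (fun i => (hs i).le) hw_pi).trans_eq' ?_)
    have h_inner (i : ι) : inner ℝ (s i) w ^ 2 = ‖w‖ ^ 2 := by
      rw [Real.inner_apply, mul_pow, ← sq_abs (s i), hs, Real.norm_eq_abs, sq_abs]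
      ring
    simp only [h_inner, Finset.sum_const, Finset.card_univ, nsmul_eq_mul, hA]
    ring
  have h := measureReal_norm_sum_smul_le hind hlaw s hδ hκ_pos hκ ht (by positivity)
    (by positivity) h_defect
  convert! h using 1
  have h_vol : (volume : Measure ℝ).real (Metric.ball 0 1) = 2 := by simp [measureReal_def]
  rw [Module.finrank_self, h_vol, Real.sqrt_eq_rpow, hA]
  have h_base : Real.pi / (κ * (2 * Fintype.card ι / Real.pi ^ 2) * δ ^ 2 / 2) =
      Real.pi ^ 3 / (κ * δ ^ 2 * Fintype.card ι) := by field_simp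
  rw [h_base]
  push_cast
  ring_nf

theorem measureReal_norm_sum_smul_addChar_le {G : Type*} [AddCommGroup G] [Fintype G]
    {X : G → Ω → ℝ} (hind : iIndepFun X P) (hlaw : ∀ g, HasLaw (X g) μ P) (hδ : 0 < δ)
    (hκ_pos : 0 < κ) (hκ : κ ≤ (symmetrization μ).real {x | ‖x‖ ∈ Set.Icc δ Λ}) (ht : 0 < t)
    {ψ : AddChar G ℂ} (hψ : ψ ^ 2 ≠ 1) {g₀ : G} {m : ℕ} (hm : IsPrimitiveRoot (ψ g₀) m)
    (htm : Λ ≤ t ∨ 2 * Real.pi * (Λ / t) ≤ m) :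
    P.real {ω | ‖∑ g, X g ω • ψ g‖ ≤ t} ≤
      32 * Real.pi ^ 2 * t ^ 2 / (κ * δ ^ 2 * Fintype.card G) +
        16 * Real.exp (-(κ * Fintype.card G / (8 * Real.pi ^ 4))) := by
  have : (0 : ℝ) < Fintype.card G := by exact_mod_cast Fintype.card_pos
  have h := measureReal_norm_sum_smul_le hind hlaw ψ hδ hκ_pos hκ ht
    (A := Fintype.card G / Real.pi ^ 2) (b := Fintype.card G / (4 * Real.pi ^ 4)) (by positivity)
    (by positivity) fun w hw => min_le_cosDefect_addChar hψ hm (htm.imp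
      (fun h => hw.trans ((div_le_one ht).2 h)) (le_trans (by gcongr)))
  convert! h using 1
  have h_vol : (volume : Measure ℂ).real (Metric.ball 0 1) = Real.pi := by
    simp [measureReal_def]
  rw [Complex.finrank_real_complex, h_vol, Nat.cast_ofNat, div_self two_ne_zero, Real.rpow_one]
  field_simp
  ring_nf

end SmallBall

section Circulant

open Matrix
open scoped ZMod

variable {n : ℕ} [NeZero n]

theorem dft_circulant_mulVec (a v : ZMod n → ℂ) (k : ZMod n) :
    𝓕 (circulant a *ᵥ v) k = 𝓕 a k * 𝓕 v k := by
  have h_shift (j : ZMod n) : ∑ i, ZMod.stdAddChar (-(i * k)) * a (i - j) =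
      ZMod.stdAddChar (-(j * k)) * 𝓕 a k := by
    rw [ZMod.dft_apply, Finset.mul_sum, ← Equiv.sum_comp (Equiv.addRight j)]
    refine Finset.sum_congr rfl fun i _ => ?_
    rw [Equiv.coe_addRight, add_sub_cancel_right, add_mul, neg_add_rev, AddChar.map_add_eq_mul,
      smul_eq_mul, mul_assoc]
  rw [ZMod.dft_apply, ZMod.dft_apply v, Finset.mul_sum]
  simp only [mulVec, dotProduct, circulant_apply, smul_eq_mul, Finset.mul_sum]
  rw [Finset.sum_comm]
  refine Finset.sum_congr rfl fun j _ => ?_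
  simp only [← mul_assoc]
  rw [← Finset.sum_mul, h_shift, mul_comm (𝓕 a k)]

theorem dft_star_neg (a : ZMod n → ℂ) (k : ZMod n) :
    𝓕 (star fun j => a (-j)) k = star (𝓕 a k) := by
  rw [ZMod.dft_apply, ZMod.dft_apply, star_sum, ← Equiv.sum_comp (Equiv.neg _)]
  refine Finset.sum_congr rfl fun j _ => ?_
  rw [Equiv.neg_apply, Pi.star_apply, neg_neg, neg_mul, AddChar.map_neg_eq_conj, star_smul,
    Complex.star_def]

theorem exists_norm_dft_sq_eq_of_eigenvector {a v : ZMod n → ℂ} (hv : v ≠ 0) {s : ℂ}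
    (hs : (circulant a)ᴴ *ᵥ (circulant a *ᵥ v) = s • v) : ∃ k, (‖𝓕 a k‖ : ℂ) ^ 2 = s := by
  obtain ⟨k, hk⟩ := Function.ne_iff.1 ((map_ne_zero_iff _ (ZMod.dft (E := ℂ)).injective).2 hv)
  refine ⟨k, mul_right_cancel₀ hk ?_⟩
  have h := congrArg (fun u => 𝓕 u k) hs
  simp only [conjTranspose_circulant, dft_circulant_mulVec, dft_star_neg, map_smul] at h
  rw [← Complex.conj_mul', mul_assoc]
  exact h

theorem exists_norm_dft_eq_sigmaMin (x : ℕ → ℝ) :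
    ∃ k : ZMod n, ‖𝓕 (fun j : ZMod n => (x j.val : ℂ)) k‖ = sigmaMin (rowCirculant n x) := by
  obtain ⟨N, rfl⟩ := Nat.exists_eq_succ_of_ne_zero (NeZero.ne n)
  set A := rowCirculant (N + 1) x
  set a : ZMod (N + 1) → ℂ := fun j => x j.val
  obtain ⟨v, hv, hv_ne⟩ :=
    ((toEuclideanLin A).hasEigenvalue_adjoint_comp_self_sq_singularValues
      (n := N) (by simp)).exists_hasEigenvector
  rw [Module.End.mem_eigenspace_iff, ← toEuclideanLin_conjTranspose_eq_adjoint] at hv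
  have h_real : Aᴴ *ᵥ (A *ᵥ v) = sigmaMin A ^ 2 • v.ofLp := congrArg WithLp.ofLp hv
  have h_map : A.map Complex.ofRealHom = circulant fun j => a (-j) := by
    ext i j
    exact congrArg a (neg_sub i j).symm
  have h_complex : (A.map Complex.ofRealHom)ᴴ *ᵥ
      (A.map Complex.ofRealHom *ᵥ (Complex.ofRealHom ∘ v.ofLp)) =
        (sigmaMin A : ℂ) ^ 2 • (Complex.ofRealHom ∘ v.ofLp) := by
    have h_mulVec (B : Matrix (Fin (N + 1)) (Fin (N + 1)) ℝ) (u : Fin (N + 1) → ℝ) :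
        B.map Complex.ofRealHom *ᵥ (Complex.ofRealHom ∘ u) = Complex.ofRealHom ∘ (B *ᵥ u) :=
      funext fun i => (Complex.ofRealHom.map_mulVec B u i).symm
    rw [← conjTranspose_map Complex.ofRealHom fun r => (Complex.conj_ofReal r).symm, h_mulVec,
      h_mulVec, h_real]
    ext i
    simp
  rw [h_map] at h_complex
  obtain ⟨k, hk⟩ := exists_norm_dft_sq_eq_of_eigenvector (fun h => hv_ne <| by
    ext i
    exact Complex.ofReal_eq_zero.1 (congrFun h i)) h_complex
  rw [ZMod.dft_comp_neg] at hk
  refine ⟨-k, ?_⟩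
  refine (pow_left_inj₀ (norm_nonneg _) (LinearMap.singularValues_nonneg _ _) two_ne_zero).1 ?_
  exact_mod_cast hk

end Circulant

section Modes

open scoped ZMod

variable {n : ℕ} [NeZero n]

theorem dft_ofReal_eq_sum_smul_mulShift (x : ZMod n → ℝ) (k : ZMod n) :
    𝓕 (fun j => (x j : ℂ)) k = ∑ j, x j • (ZMod.stdAddChar (N := n)).mulShift (-k) j := by
  rw [ZMod.dft_apply]
  refine Finset.sum_congr rfl fun j _ => ?_
  rw [AddChar.mulShift_apply, neg_mul, mul_comm k, smul_eq_mul, mul_comm, Complex.real_smul]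

theorem stdAddChar_mulShift_sq_eq_one_iff (k : ZMod n) :
    (ZMod.stdAddChar (N := n)).mulShift k ^ 2 = 1 ↔ 2 • k = 0 := by
  rw [AddChar.pow_mulShift, AddChar.mulShift_mulShift, mul_comm, ← nsmul_eq_mul,
    ← AddChar.mulShift_zero ZMod.stdAddChar,
    (AddChar.to_mulShift_inj_of_isPrimitive (ZMod.isPrimitive_stdAddChar n)).eq_iff]

theorem isPrimitiveRoot_stdAddChar_mulShift_one (k : ZMod n) :
    IsPrimitiveRoot ((ZMod.stdAddChar (N := n)).mulShift k 1) (addOrderOf k) := by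
  rw [AddChar.mulShift_apply, mul_one, IsPrimitiveRoot.iff_def]
  have h_iff (l : ℕ) : ZMod.stdAddChar k ^ l = 1 ↔ addOrderOf k ∣ l := by
    rw [← AddChar.map_nsmul_eq_pow, ← AddChar.map_zero_eq_one (ZMod.stdAddChar (N := n)),
      ZMod.injective_stdAddChar.eq_iff, addOrderOf_dvd_iff_nsmul_eq_zero]
  exact ⟨(h_iff _).2 dvd_rfl, fun l => (h_iff l).1⟩

theorem ofReal_re_eq_and_abs_re_eq_one_of_sq_eq_one {z : ℂ} (hz : z ^ 2 = 1) :
    (z.re : ℂ) = z ∧ |z.re| = 1 := by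
  rcases sq_eq_one_iff.1 hz with rfl | rfl <;> simp

theorem card_two_nsmul_eq_zero_le : Finset.card {k : ZMod n | 2 • k = 0} ≤ 2 :=
  IsAddCyclic.card_nsmul_eq_zero_le two_pos

theorem card_addOrderOf_lt_le {R : ℝ} (hR : 0 ≤ R) :
    (Finset.card {k : ZMod n | (addOrderOf k : ℝ) < R} : ℝ) ≤ R ^ 2 := by
  have h_sub : ({k : ZMod n | (addOrderOf k : ℝ) < R} : Finset (ZMod n)) ⊆
      (Finset.Icc 1 ⌊R⌋₊).biUnion fun d => {k | d • k = 0} := by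
    intro k hk
    rw [Finset.mem_filter_univ] at hk
    simp only [Finset.mem_biUnion, Finset.mem_Icc, Finset.mem_filter_univ]
    exact ⟨addOrderOf k, ⟨addOrderOf_pos k, Nat.le_floor hk.le⟩, addOrderOf_nsmul_eq_zero k⟩
  have h_card : Finset.card {k : ZMod n | (addOrderOf k : ℝ) < R} ≤ ⌊R⌋₊ * ⌊R⌋₊ := by
    refine (Finset.card_le_card h_sub).trans ?_
    refine (Finset.card_biUnion_le_card_mul _ _ ⌊R⌋₊ fun d hd => ?_).trans_eq (by simp)
    exact (IsAddCyclic.card_nsmul_eq_zero_le (Finset.mem_Icc.1 hd).1).trans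
      (Finset.mem_Icc.1 hd).2
  have h_floor := Nat.floor_le hR
  calc (Finset.card {k : ZMod n | (addOrderOf k : ℝ) < R} : ℝ) ≤ ⌊R⌋₊ * ⌊R⌋₊ := by
        exact_mod_cast h_card
    _ ≤ R ^ 2 := by rw [sq]; gcongr

theorem exp_neg_le_two_div_sq {x : ℝ} (hx : 0 < x) : Real.exp (-x) ≤ 2 / x ^ 2 := by
  rw [Real.exp_neg, ← inv_div]
  gcongr
  linarith [Real.quadratic_le_exp_of_nonneg hx.le]

end Modes

section ModesSmallBall

open scoped ZMod

variable {n : ℕ} [NeZero n] {Ω : Type*} [MeasurableSpace Ω] {P : Measure Ω}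
  [IsProbabilityMeasure P] {μ : Measure ℝ} [IsProbabilityMeasure μ] {δ Λ κ t : ℝ}
  {X : ZMod n → Ω → ℝ}

theorem measureReal_dft_le_of_two_nsmul_eq_zero
    (hind : iIndepFun X P) (hlaw : ∀ j, HasLaw (X j) μ P) (hδ : 0 < δ)
    (hκ_pos : 0 < κ) (hκ : κ ≤ (symmetrization μ).real {x | ‖x‖ ∈ Set.Icc δ Λ}) (ht : 0 < t)
    (hΛt : Λ ≤ t) {k : ZMod n} (hk : 2 • k = 0) :
    P.real {ω | ‖𝓕 (fun j => (X j ω : ℂ)) k‖ ≤ t} ≤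
      4 * t * √(Real.pi ^ 3 / (κ * δ ^ 2 * n)) + 8 * Real.exp (-(κ * n / Real.pi ^ 2)) := by
  set ψ := (ZMod.stdAddChar (N := n)).mulShift (-k) with hψ
  have h_sq : ψ ^ 2 = 1 := by
    rw [hψ, stdAddChar_mulShift_sq_eq_one_iff, smul_neg, hk, neg_zero]
  have h_sign (j : ZMod n) : ((ψ j).re : ℂ) = ψ j ∧ |(ψ j).re| = 1 :=
    ofReal_re_eq_and_abs_re_eq_one_of_sq_eq_one (DFunLike.congr_fun h_sq j)
  have h_dft (ω : Ω) : ‖𝓕 (fun j => (X j ω : ℂ)) k‖ = |∑ j, X j ω * (ψ j).re| := by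
    rw [dft_ofReal_eq_sum_smul_mulShift, ← Real.norm_eq_abs, ← Complex.norm_real,
      Complex.ofReal_sum]
    congr! 2 with j
    rw [Complex.ofReal_mul, (h_sign j).1, Complex.real_smul]
  simp only [h_dft]
  have h := measureReal_abs_sum_mul_sign_le hind hlaw hδ hκ_pos hκ ht hΛt fun j => (h_sign j).2
  rwa [ZMod.card] at h

theorem measureReal_dft_le_of_two_nsmul_ne_zero
    (hind : iIndepFun X P) (hlaw : ∀ j, HasLaw (X j) μ P) (hδ : 0 < δ)
    (hκ_pos : 0 < κ) (hκ : κ ≤ (symmetrization μ).real {x | ‖x‖ ∈ Set.Icc δ Λ}) (ht : 0 < t)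
    {k : ZMod n} (hk : 2 • k ≠ 0) (htk : Λ ≤ t ∨ 2 * Real.pi * (Λ / t) ≤ addOrderOf k) :
    P.real {ω | ‖𝓕 (fun j => (X j ω : ℂ)) k‖ ≤ t} ≤
      32 * Real.pi ^ 2 * t ^ 2 / (κ * δ ^ 2 * n) +
        16 * Real.exp (-(κ * n / (8 * Real.pi ^ 4))) := by
  have h_sq : (ZMod.stdAddChar (N := n)).mulShift (-k) ^ 2 ≠ 1 := by
    rwa [Ne, stdAddChar_mulShift_sq_eq_one_iff, smul_neg, neg_eq_zero]
  rw [← addOrderOf_neg] at htk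
  have h := measureReal_norm_sum_smul_addChar_le hind hlaw hδ hκ_pos hκ ht h_sq
    (isPrimitiveRoot_stdAddChar_mulShift_one (-k)) htk
  simpa only [dft_ofReal_eq_sum_smul_mulShift, ZMod.card] using h

end ModesSmallBall

section UnionBound

open scoped ZMod

variable {n : ℕ} [NeZero n]

theorem sum_le_of_two_nsmul_of_addOrderOf {p : ZMod n → ℝ} {R a b c : ℝ} (hR : 0 ≤ R)
    (ha : 0 ≤ a) (hb : 0 ≤ b) (hc : 0 ≤ c) (h_real : ∀ k, 2 • k = 0 → p k ≤ a)
    (h_low : ∀ k, 2 • k ≠ 0 → p k ≤ b) (h_high : ∀ k, 2 • k ≠ 0 → R ≤ addOrderOf k → p k ≤ c) :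
    ∑ k, p k ≤ 2 * a + R ^ 2 * b + n * c := by
  have h_term (k : ZMod n) :
      p k ≤ (if 2 • k = 0 then a else 0) + (if (addOrderOf k : ℝ) < R then b else 0) + c := by
    have h_low_nonneg : 0 ≤ if (addOrderOf k : ℝ) < R then b else 0 := by positivity
    by_cases hk : 2 • k = 0
    · rw [if_pos hk]
      linarith [h_real k hk]
    · rw [if_neg hk]
      split_ifs with hkR
      · linarith [h_low k hk]
      · linarith [h_high k hk (not_lt.1 hkR)]
  calc ∑ k, p k
      ≤ ∑ k : ZMod n,
          ((if 2 • k = 0 then a else 0) + (if (addOrderOf k : ℝ) < R then b else 0) + c) :=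
        Finset.sum_le_sum fun k _ => h_term k
    _ = Finset.card {k : ZMod n | 2 • k = 0} * a +
          Finset.card {k : ZMod n | (addOrderOf k : ℝ) < R} * b + n * c := by
        simp only [Finset.sum_add_distrib, Finset.sum_ite, Finset.sum_const_zero, add_zero,
          Finset.sum_const, nsmul_eq_mul, Finset.card_univ, ZMod.card]
    _ ≤ 2 * a + R ^ 2 * b + n * c := by
        gcongr
        · exact_mod_cast card_two_nsmul_eq_zero_le
        · exact card_addOrderOf_lt_le hR

theorem measureReal_sigmaMin_le_sum {Ω : Type*} [MeasurableSpace Ω] (P : Measure Ω)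
    [IsFiniteMeasure P] (ξ : ℕ → Ω → ℝ) (t : ℝ) :
    P.real {ω | sigmaMin (rowCirculant n fun j => ξ j ω) ≤ t} ≤
      ∑ k : ZMod n, P.real {ω | ‖𝓕 (fun j : ZMod n => (ξ j.val ω : ℂ)) k‖ ≤ t} := by
  refine (measureReal_mono fun ω hω => ?_).trans (measureReal_iUnion_fintype_le _)
  obtain ⟨k, hk⟩ := exists_norm_dft_eq_sigmaMin (n := n) fun j => ξ j ω
  exact Set.mem_iUnion.2 ⟨k, hk.trans_le hω⟩

end UnionBound

section SigmaMin

open scoped ZMod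

theorem exists_modes_bound_le {δ Λ κ : ℝ} (hδ : 0 < δ) (hΛ : 0 < Λ) (hκ : 0 < κ) :
    ∃ K : ℝ, 0 < K ∧ ∀ n : ℕ, n ≠ 0 →
      4 * Λ * √(Real.pi ^ 3 / (κ * δ ^ 2 * n)) + 8 * Real.exp (-(κ * n / Real.pi ^ 2)) ≤ K / √n ∧
      ∀ t : ℝ, 32 * Real.pi ^ 2 * t ^ 2 / (κ * δ ^ 2 * n) +
        16 * Real.exp (-(κ * n / (8 * Real.pi ^ 4))) ≤ K * (t ^ 2 / n + 1 / (n : ℝ) ^ 2) := by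
  set K₁ := 4 * Λ * √(Real.pi ^ 3 / (κ * δ ^ 2)) + 16 * (Real.pi ^ 2 / κ) ^ 2
  set K₂ := 32 * Real.pi ^ 2 / (κ * δ ^ 2) + 32 * (8 * Real.pi ^ 4 / κ) ^ 2
  have hK₁_pos : 0 < K₁ := by positivity
  have hK₂_pos : 0 < K₂ := by positivity
  refine ⟨K₁ + K₂, by positivity, fun n hn => ?_⟩
  have hn_one : (1 : ℝ) ≤ n := by exact_mod_cast Nat.one_le_iff_ne_zero.2 hn
  have h_exp {a : ℝ} (ha : 0 < a) : Real.exp (-(κ * n / a)) ≤ 2 * (a / κ) ^ 2 / n ^ 2 :=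
    (exp_neg_le_two_div_sq (by positivity)).trans_eq (by field_simp)
  have h_sqrt_le : √(n : ℝ) ≤ n ^ 2 := by
    rw [Real.sqrt_le_left (by positivity)]
    exact (le_self_pow₀ hn_one four_ne_zero).trans_eq (pow_mul (n : ℝ) 2 2)
  constructor
  · calc 4 * Λ * √(Real.pi ^ 3 / (κ * δ ^ 2 * n)) + 8 * Real.exp (-(κ * n / Real.pi ^ 2))
        ≤ 4 * Λ * (√(Real.pi ^ 3 / (κ * δ ^ 2)) / √n) +
            8 * (2 * (Real.pi ^ 2 / κ) ^ 2 / √n) := by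
          rw [← div_div, Real.sqrt_div' _ (by positivity)]
          gcongr
          refine (h_exp (by positivity)).trans ?_
          gcongr
      _ = K₁ / √n := by ring
      _ ≤ (K₁ + K₂) / √n := by gcongr; linarith
  · intro t
    calc 32 * Real.pi ^ 2 * t ^ 2 / (κ * δ ^ 2 * n) +
          16 * Real.exp (-(κ * n / (8 * Real.pi ^ 4)))
        ≤ 32 * Real.pi ^ 2 * t ^ 2 / (κ * δ ^ 2 * n) +
            16 * (2 * (8 * Real.pi ^ 4 / κ) ^ 2 / n ^ 2) := by
          gcongr
          exact h_exp (by positivity)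
      _ = 32 * Real.pi ^ 2 / (κ * δ ^ 2) * (t ^ 2 / n) +
            32 * (8 * Real.pi ^ 4 / κ) ^ 2 * (1 / n ^ 2) := by
          field_simp
          ring
      _ ≤ (K₁ + K₂) * (t ^ 2 / n) + (K₁ + K₂) * (1 / n ^ 2) := by
          have : 0 ≤ 32 * Real.pi ^ 2 / (κ * δ ^ 2) := by positivity
          have : 0 ≤ 32 * (8 * Real.pi ^ 4 / κ) ^ 2 := by positivity
          gcongr <;> linarith
      _ = (K₁ + K₂) * (t ^ 2 / n + 1 / n ^ 2) := by ring

theorem modes_bound_sum_le {n : ℕ} (hn : n ≠ 0) {Λ K t : ℝ} (hK : 0 ≤ K) (ht : 0 < t)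
    (htn : 1 / √n ≤ t ^ 2) :
    2 * (K / √n) + (2 * Real.pi * (Λ / t)) ^ 2 * (K * (Λ ^ 2 / n + 1 / (n : ℝ) ^ 2)) +
        n * (K * (t ^ 2 / n + 1 / (n : ℝ) ^ 2)) ≤
      (3 + 4 * Real.pi ^ 2 * Λ ^ 2 * (Λ ^ 2 + 1)) * K * (t ^ 2 + 1 / √n) := by
  have hn_one : (1 : ℝ) ≤ n := by exact_mod_cast Nat.one_le_iff_ne_zero.2 hn
  set r := 1 / √(n : ℝ) with hr
  have hr_pos : 0 < r := by positivity
  have hr_one : r ≤ 1 := (div_le_one (by positivity)).2 (Real.one_le_sqrt.2 hn_one)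
  have hr_sq : r ^ 2 = 1 / n := by rw [hr, div_pow, Real.sq_sqrt (by positivity), one_pow]
  have hr_sq_le : r ^ 2 ≤ r := by nlinarith
  have h_low : (2 * Real.pi * (Λ / t)) ^ 2 * (K * (Λ ^ 2 / n + 1 / (n : ℝ) ^ 2)) ≤
      4 * Real.pi ^ 2 * Λ ^ 2 * (Λ ^ 2 + 1) * K * r := by
    calc (2 * Real.pi * (Λ / t)) ^ 2 * (K * (Λ ^ 2 / n + 1 / (n : ℝ) ^ 2))
        = 4 * Real.pi ^ 2 * Λ ^ 2 * (Λ ^ 2 + r ^ 2) * K * r * (r / t ^ 2) := by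
          rw [div_eq_mul_one_div (Λ ^ 2), ← one_div_pow, ← hr_sq]
          ring
      _ ≤ 4 * Real.pi ^ 2 * Λ ^ 2 * (Λ ^ 2 + 1) * K * r * 1 := by
          gcongr
          · exact hr_sq_le.trans hr_one
          · exact (div_le_one (by positivity)).2 htn
      _ = 4 * Real.pi ^ 2 * Λ ^ 2 * (Λ ^ 2 + 1) * K * r := mul_one _
  have h_high : n * (K * (t ^ 2 / n + 1 / (n : ℝ) ^ 2)) ≤ K * (t ^ 2 + r) := by
    calc n * (K * (t ^ 2 / n + 1 / (n : ℝ) ^ 2)) = K * (t ^ 2 + r ^ 2) := by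
          rw [hr_sq]
          field_simp
      _ ≤ K * (t ^ 2 + r) := by gcongr
  have h_slack : 0 ≤ (2 + 4 * Real.pi ^ 2 * Λ ^ 2 * (Λ ^ 2 + 1)) * K * t ^ 2 := by positivity
  rw [div_eq_mul_one_div K]
  linarith

/-- Small-ball bounds with constant `K` for the Fourier modes of a random vector `X` on `ZMod n`.
The real modes are only controlled at the radius `Λ`, and a complex mode at a radius `s < Λ` only if
its frequency has order at least `2πΛ/s`: these are the estimates that survive the union bound. -/
structure SmallBallModes {Ω : Type*} [MeasurableSpace Ω] (P : Measure Ω) {n : ℕ} [NeZero n]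
    (X : ZMod n → Ω → ℝ) (Λ K : ℝ) : Prop where
  le_of_two_nsmul_eq_zero : ∀ k : ZMod n, 2 • k = 0 →
    P.real {ω | ‖𝓕 (fun j => (X j ω : ℂ)) k‖ ≤ Λ} ≤ K / √n
  le_of_two_nsmul_ne_zero : ∀ (s : ℝ) (k : ZMod n), 0 < s → 2 • k ≠ 0 →
    Λ ≤ s ∨ 2 * Real.pi * (Λ / s) ≤ addOrderOf k →
      P.real {ω | ‖𝓕 (fun j => (X j ω : ℂ)) k‖ ≤ s} ≤ K * (s ^ 2 / n + 1 / (n : ℝ) ^ 2)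

theorem exists_smallBallModes {μ : Measure ℝ} [IsProbabilityMeasure μ]
    (hμ : ∀ a, μ ≠ Measure.dirac a) :
    ∃ Λ K : ℝ, 0 < Λ ∧ 0 < K ∧ ∀ (Ω : Type*) [MeasurableSpace Ω] (P : Measure Ω)
      [IsProbabilityMeasure P] (n : ℕ) [NeZero n] (X : ZMod n → Ω → ℝ), iIndepFun X P →
        (∀ j, HasLaw (X j) μ P) → SmallBallModes P X Λ K := by
  obtain ⟨δ, Λ, hδ, hΛ, hκ⟩ := exists_symmetrization_annulus_pos hμ
  obtain ⟨K, hK, h_bound⟩ := exists_modes_bound_le hδ hΛ hκ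
  refine ⟨Λ, K, hΛ, hK, fun Ω _ P _ n _ X hind hlaw => ⟨fun k hk => ?_, fun s k hs hk hks => ?_⟩⟩
  · exact (measureReal_dft_le_of_two_nsmul_eq_zero hind hlaw hδ hκ le_rfl hΛ le_rfl hk).trans
      (h_bound n (NeZero.ne n)).1
  · exact (measureReal_dft_le_of_two_nsmul_ne_zero hind hlaw hδ hκ le_rfl hs hk hks).trans
      ((h_bound n (NeZero.ne n)).2 s)

namespace SmallBallModes

variable {Ω : Type*} [MeasurableSpace Ω] {P : Measure Ω} {n : ℕ} [NeZero n] {ξ : ℕ → Ω → ℝ}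
  {Λ K : ℝ}

theorem measureReal_sigmaMin_le_of_le [IsFiniteMeasure P]
    (h : SmallBallModes P (fun j : ZMod n => ξ j.val) Λ K) (hK : 0 ≤ K) {t : ℝ} (ht : 0 < t)
    (htΛ : t ≤ Λ) (htn : 1 / √n ≤ t ^ 2) :
    P.real {ω | sigmaMin (rowCirculant n fun j => ξ j ω) ≤ t} ≤
      (3 + 4 * Real.pi ^ 2 * Λ ^ 2 * (Λ ^ 2 + 1)) * K * (t ^ 2 + 1 / √n) := by
  have hΛ : 0 < Λ := ht.trans_le htΛ
  have h_radius (k : ZMod n) : P.real {ω | ‖𝓕 (fun j : ZMod n => (ξ j.val ω : ℂ)) k‖ ≤ t} ≤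
      P.real {ω | ‖𝓕 (fun j : ZMod n => (ξ j.val ω : ℂ)) k‖ ≤ Λ} :=
    measureReal_mono fun ω hω => le_trans hω htΛ
  refine (measureReal_sigmaMin_le_sum P ξ t).trans ?_
  refine (sum_le_of_two_nsmul_of_addOrderOf (R := 2 * Real.pi * (Λ / t)) (by positivity)
    (by positivity : 0 ≤ K / √n) (by positivity : 0 ≤ K * (Λ ^ 2 / n + 1 / (n : ℝ) ^ 2))
    (by positivity : 0 ≤ K * (t ^ 2 / n + 1 / (n : ℝ) ^ 2))
    (fun k hk => (h_radius k).trans (h.le_of_two_nsmul_eq_zero k hk))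
    (fun k hk => (h_radius k).trans (h.le_of_two_nsmul_ne_zero Λ k hΛ hk (.inl le_rfl)))
    (fun k hk hkR => h.le_of_two_nsmul_ne_zero t k ht hk (.inr hkR))).trans ?_
  exact modes_bound_sum_le (NeZero.ne n) hK ht htn

theorem measureReal_sigmaMin_le [IsProbabilityMeasure P]
    (h : SmallBallModes P (fun j : ZMod n => ξ j.val) Λ K) (hΛ : 0 < Λ) (hK : 0 ≤ K) (t : ℝ) :
    P.real {ω | sigmaMin (rowCirculant n fun j => ξ j ω) ≤ t} ≤
      (2 * ((3 + 4 * Real.pi ^ 2 * Λ ^ 2 * (Λ ^ 2 + 1)) * K) + 1 / Λ ^ 2) *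
        (t ^ 2 + 1 / √n) := by
  have h_pos : 0 < t ^ 2 + 1 / √n := by have := NeZero.pos n; positivity
  -- At radius `s`, at most `(2πΛ / s)² = O(√n)` frequencies have order below `2πΛ / s`.
  set s := √(t ^ 2 + 1 / √n)
  have hs : 0 < s := Real.sqrt_pos.2 h_pos
  have hs_sq : s ^ 2 = t ^ 2 + 1 / √n := Real.sq_sqrt h_pos.le
  have hts : t ≤ s := Real.le_sqrt_of_sq_le (le_add_of_nonneg_right (by positivity))
  have hsn : 1 / √n ≤ s ^ 2 := hs_sq ▸ le_add_of_nonneg_left (sq_nonneg t)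
  rw [← hs_sq, add_mul]
  rcases le_total s Λ with hsΛ | hΛs
  · refine (measureReal_mono fun ω (hω : _ ≤ t) => hω.trans hts).trans
      ((h.measureReal_sigmaMin_le_of_le hK hs hsΛ hsn).trans (le_add_of_le_of_nonneg ?_ ?_))
    · rw [mul_comm 2, mul_assoc _ 2]
      gcongr
      linarith
    · positivity
  · refine measureReal_le_one.trans (le_add_of_nonneg_of_le (by positivity) ?_)
    rw [one_div_mul_eq_div, one_le_div (by positivity)]
    gcongr

end SmallBallModes

end SigmaMin

theorem ConditionH.ne_dirac {μ : Measure ℝ} (hμ : ConditionH μ) (a : ℝ) : μ ≠ Measure.dirac a := by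
  obtain ⟨-, q, -, hq, -, h_sup, -⟩ := hμ
  rintro rfl
  have h_one : (1 : ℝ≥0∞) ≤ ENNReal.ofReal (1 - q) := by
    refine le_trans ?_ ((le_iSup _ a).trans h_sup)
    rw [Measure.dirac_apply_of_mem (by simp)]
  rw [ENNReal.one_le_ofReal] at h_one
  linarith

theorem mainTheorem2_general (μ : Measure ℝ) [IsProbabilityMeasure μ]
    (hμ : ∀ a, μ ≠ Measure.dirac a) :
    ∃ C : ℝ, 0 < C ∧ ∀ (Ω : Type*) [MeasurableSpace Ω] (P : Measure Ω) [IsProbabilityMeasure P]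
      (ξ : ℕ → Ω → ℝ), iIndepFun ξ P → (∀ j, HasLaw (ξ j) μ P) → ∀ n : ℕ, n ≠ 0 → ∀ t : ℝ,
        P.real {ω | sigmaMin (rowCirculant n fun j => ξ j ω) ≤ t} ≤ C * (t ^ 2 + 1 / √n) := by
  obtain ⟨Λ, K, hΛ, hK, h_modes⟩ := exists_smallBallModes hμ
  refine ⟨2 * ((3 + 4 * Real.pi ^ 2 * Λ ^ 2 * (Λ ^ 2 + 1)) * K) + 1 / Λ ^ 2, by positivity, ?_⟩
  intro Ω _ P _ ξ hind hlaw n hn t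
  have : NeZero n := ⟨hn⟩
  exact (h_modes Ω P n _ (hind.precomp (ZMod.val_injective n)) fun _ =>
    hlaw _).measureReal_sigmaMin_le hΛ hK.le t

theorem mainTheorem2 (μ : Measure ℝ) [IsProbabilityMeasure μ] (hμ : ConditionH μ) :
    ∃ C : ℝ, 0 < C ∧ ∃ o : ℕ → ℝ, Tendsto o atTop (𝓝 0) ∧
      ∀ (Ω : Type*) [MeasurableSpace Ω] (P : Measure Ω) [IsProbabilityMeasure P]
        (ξ : ℕ → Ω → ℝ), iIndepFun ξ P → (∀ j, HasLaw (ξ j) μ P) →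
        ∀ ε : ℝ, 0 < ε → ∀ ρ : ℝ, 0 < ρ → ρ < 1 / 4 →
          ∀ᶠ n : ℕ in atTop,
            P.real {ω | sigmaMin (rowCirculant n fun j => ξ j ω) ≤ ε * (n : ℝ) ^ (-ρ)} ≤
              C * ((ε ^ 2 + ε) / (n : ℝ) ^ (2 * ρ) + 1 / (n : ℝ) ^ (1 / 2 - o n)) := by
  obtain ⟨C, hC, h_bound⟩ := mainTheorem2_general μ hμ.ne_dirac
  refine ⟨C, hC, fun _ => 0, tendsto_const_nhds, ?_⟩
  intro Ω _ P _ ξ hind hlaw ε hε ρ _ _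
  filter_upwards [eventually_ne_atTop 0] with n hn
  refine (h_bound Ω P ξ hind hlaw n hn _).trans ?_
  rw [sub_zero, ← Real.sqrt_eq_rpow, mul_pow, ← Real.rpow_mul_natCast n.cast_nonneg,
    Nat.cast_ofNat, neg_mul, mul_comm ρ, Real.rpow_neg n.cast_nonneg, ← div_eq_mul_inv]
  gcongr
  exact le_add_of_nonneg_right hε.le
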